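/- Let $M$ be a smooth manifold without boundary. An almost Kähler structure on $M$ is a triple $(\omega,\Theta,g)$ consisting of a symplectic form $\omega$ (a smooth, closed, nondegenerate 2-form), an almost complex structure $\Theta$ (a smooth endomorphism field with $\Theta^2=-1$), and a smooth Riemannian metric $g$ with $g(\Theta X,\Theta Y)=g(X,Y)$ and $\omega(X,Y)=g(\Theta X,Y)$. It is Kähler if moreover $\Theta$ is integrable, i.e. the Nijenhuis tensor $[\Theta X,\Theta Y]-\Theta[\Theta X,Y]-\Theta[X,\Theta Y]-[X,Y]$ vanishes for all vector fields $X,Y$. A symplectic connection of $(M,\omega)$ is a smooth torsion-free linear connection $\nabla$ with $\nabla\omega=0$. The $g$-dual of a smooth linear connection $\nabla$ is the smooth linear connection $\nabla^*$ with $X\cdot g(Y,Z)=g(\nabla_XY,Z)+g(Y,\nabla^*_XZ)$ for all vector fields $X,Y,Z$. A pair $(\nabla,\nabla^*)$ of $g$-dual connections is called statistical if both are torsion-free. The almost Kähler manifold $(M,\omega,\Theta,g)$ is called statistical almost Kähler if there is a symplectic connection $\nabla$ of $(M,\omega)$ such that $(\nabla,\nabla^*)$ is statistical, i.e. such that its $g$-dual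 $\nabla^*$ is also torsion-free. **Proposition.** Let $(M,\omega,\Theta,g)$ be an almost Kähler manifold. 1. $(M,\omega,\Theta,g)$ is Kähler if and only if it is statistical almost Kähler. 2. Call a Riemannian metric $h$ on $M$ a Hermitian (respectively Kähler) metric of the symplectic manifold $(M,\omega)$ if there is an almost complex structure $J$ such that $(\omega,J,h)$ is an almost Kähler (respectively Kähler) structure. Then a Riemannian metric $h$ on $M$ is a Kähler metric of $(M,\omega)$ if and only if it is a Hermitian metric of $(M,\omega)$ and there is a symplectic connection of $(M,\omega)$ whose $h$-dual is again a symplectic connection of $(M,\omega)$. -/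

import Mathlib

open Bundle Set
open scoped Manifold ContDiff Bundle

noncomputable section

namespace AlmostKahlerGeometry

variable {E : Type*} [NormedAddCommGroup E] [NormedSpace ℝ E]
  {H : Type*} [TopologicalSpace H] (I : ModelWithCorners ℝ E H)
  (M : Type*) [TopologicalSpace M] [ChartedSpace H M]

/-- A (not necessarily smooth) vector field on `M`. -/
abbrev Field : Type _ := Π x : M, TangentSpace I x

/-- A (not necessarily smooth) field of bilinear forms on the tangent spaces of `M`. -/
abbrev BilinField : Type _ := Π x : M, TangentSpace I x →L[ℝ] TangentSpace I x →L[ℝ] ℝ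

/-- A (not necessarily smooth) field of endomorphisms of the tangent spaces of `M`. -/
abbrev EndField : Type _ := Π x : M, TangentSpace I x →L[ℝ] TangentSpace I x

/-- A linear connection on `M`, i.e. a covariant derivative on the tangent bundle. In Mathlib's
argument order, `D Y x (X x)` is the value at `x` of the covariant derivative of `Y` along `X`. -/
abbrev LinearConnection [IsManifold I ∞ M] : Type _ :=
  CovariantDerivative I E (fun x : M ↦ TangentSpace I x)

/-- A smooth Riemannian metric on `M`; `g.inner x v w` is the scalar product of `v, w` at `x`. -/
abbrev Metric [IsManifold I ∞ M] : Type _ :=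
  ContMDiffRiemannianMetric I ∞ E (fun x : M ↦ TangentSpace I x)

variable {I M}

/-- Smooth vector fields. -/
def IsSmoothField [IsManifold I ∞ M] (X : Field I M) : Prop :=
  ContMDiff I (I.prod 𝓘(ℝ, E)) ∞ (fun x ↦ TotalSpace.mk' E x (X x))

/-- Smooth `(0,2)`-tensor fields. -/
def IsSmoothBilin [IsManifold I ∞ M] (b : BilinField I M) : Prop :=
  ContMDiff I (I.prod 𝓘(ℝ, E →L[ℝ] E →L[ℝ] ℝ)) ∞
    (fun x ↦ TotalSpace.mk' (E →L[ℝ] E →L[ℝ] ℝ) x (b x))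

/-- Smooth `(1,1)`-tensor fields. -/
def IsSmoothEnd [IsManifold I ∞ M] (A : EndField I M) : Prop :=
  ContMDiff I (I.prod 𝓘(ℝ, E →L[ℝ] E)) ∞ (fun x ↦ TotalSpace.mk' (E →L[ℝ] E) x (A x))

/-- The derivative `X · f` of a function along a vector field. -/
def lieDeriv (X : Field I M) (f : M → ℝ) (x : M) : ℝ := mvfderiv I f x (X x)

/-- The function `b(X, Y)`. -/
def pair (b : BilinField I M) (X Y : Field I M) (x : M) : ℝ := b x (X x) (Y x)

/-- The vector field `A X`. -/
def act (A : EndField I M) (X : Field I M) : Field I M := fun x ↦ A x (X x)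

/-- The vector field `∇_X Y`. -/
def along [IsManifold I ∞ M] (D : LinearConnection I M) (X Y : Field I M) : Field I M := fun x ↦ D Y x (X x)

/-- Invariant formula for the exterior derivative of a 2-form:
`X·Ω(Y,Z) + Y·Ω(Z,X) + Z·Ω(X,Y) - Ω([X,Y],Z) - Ω([Y,Z],X) - Ω([Z,X],Y)`. -/
def extDerivTwoForm (Ω : BilinField I M) (X Y Z : Field I M) (x : M) : ℝ :=
  lieDeriv X (pair Ω Y Z) x + lieDeriv Y (pair Ω Z X) x + lieDeriv Z (pair Ω X Y) x
    - pair Ω (VectorField.mlieBracket I X Y) Z x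
    - pair Ω (VectorField.mlieBracket I Y Z) X x
    - pair Ω (VectorField.mlieBracket I Z X) Y x

/-- A symplectic form: a smooth, closed, nondegenerate 2-form. -/
structure IsSymplecticForm [IsManifold I ∞ M] (Ω : BilinField I M) : Prop where
  smooth : IsSmoothBilin Ω
  alternating : ∀ (x : M) (v : TangentSpace I x), Ω x v v = 0
  nondegenerate : ∀ (x : M) (v : TangentSpace I x), (∀ w, Ω x v w = 0) → v = 0
  closed : ∀ X Y Z : Field I M, IsSmoothField X → IsSmoothField Y → IsSmoothField Z →
    ∀ x, extDerivTwoForm Ω X Y Z x = 0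

/-- An almost complex structure: a smooth endomorphism field with square `-1`. -/
structure IsAlmostComplex [IsManifold I ∞ M] (Θ : EndField I M) : Prop where
  smooth : IsSmoothEnd Θ
  sq : ∀ (x : M) (v : TangentSpace I x), Θ x (Θ x v) = -v

/-- The Nijenhuis tensor `[ΘX,ΘY] - Θ[ΘX,Y] - Θ[X,ΘY] + Θ²[X,Y]`, where `Θ² = -1`. -/
def nijenhuis (Θ : EndField I M) (X Y : Field I M) (x : M) : TangentSpace I x :=
  VectorField.mlieBracket I (act Θ X) (act Θ Y) x
    - Θ x (VectorField.mlieBracket I (act Θ X) Y x)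
    - Θ x (VectorField.mlieBracket I X (act Θ Y) x)
    - VectorField.mlieBracket I X Y x

/-- Integrability of an almost complex structure: its Nijenhuis tensor vanishes. -/
def IsIntegrable [IsManifold I ∞ M] (Θ : EndField I M) : Prop :=
  ∀ X Y : Field I M, IsSmoothField X → IsSmoothField Y → ∀ x, nijenhuis Θ X Y x = 0

/-- `(M, Ω, Θ, g)` is almost Kähler: `Ω` is a symplectic form, `Θ` is an almost complex structure,
`g` is a Hermitian metric, and `Ω = g(Θ·,·)`. -/
structure IsAlmostKahler [IsManifold I ∞ M]
    (Ω : BilinField I M) (Θ : EndField I M) (g : Metric I M) : Prop where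
  symplectic : IsSymplecticForm Ω
  almostComplex : IsAlmostComplex Θ
  hermitian : ∀ (x : M) (v w : TangentSpace I x), g.inner x (Θ x v) (Θ x w) = g.inner x v w
  fundamental : ∀ (x : M) (v w : TangentSpace I x), Ω x v w = g.inner x (Θ x v) w

/-- `(M, Ω, Θ, g)` is Kähler: it is almost Kähler and `Θ` is integrable. -/
structure IsKahler [IsManifold I ∞ M]
    (Ω : BilinField I M) (Θ : EndField I M) (g : Metric I M) : Prop where
  almostKahler : IsAlmostKahler Ω Θ g
  integrable : IsIntegrable Θ

/-- A smooth linear connection: it maps smooth fields to smooth fields. -/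
def IsSmoothConnection [IsManifold I ∞ M] (D : LinearConnection I M) : Prop :=
  CovariantDerivative.ContMDiffCovariantDerivative D ∞

/-- A torsion-free linear connection: `∇_X Y - ∇_Y X = [X, Y]`. -/
def IsTorsionFree [IsManifold I ∞ M] [FiniteDimensional ℝ E] [CompleteSpace E]
    (D : LinearConnection I M) : Prop :=
  D.torsion = 0

/-- `∇Ω = 0`. -/
def IsParallel [IsManifold I ∞ M] (D : LinearConnection I M) (Ω : BilinField I M) : Prop :=
  ∀ X Y Z : Field I M, IsSmoothField X → IsSmoothField Y → IsSmoothField Z → ∀ x,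
    lieDeriv X (pair Ω Y Z) x = pair Ω (along D X Y) Z x + pair Ω Y (along D X Z) x

/-- A symplectic connection of `(M, Ω)`: a smooth torsion-free linear connection with `∇Ω = 0`. -/
structure IsSymplecticConnection [IsManifold I ∞ M] [FiniteDimensional ℝ E] [CompleteSpace E]
    (Ω : BilinField I M) (D : LinearConnection I M) : Prop where
  smooth : IsSmoothConnection D
  torsionFree : IsTorsionFree D
  parallel : IsParallel D Ω

/-- `(∇, ∇*)` is a dualistic structure on `(M, g)`, i.e. `∇*` is the `g`-dual connection of `∇`:
`X·g(Y,Z) = g(∇_X Y, Z) + g(Y, ∇*_X Z)`. -/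
structure IsDual [IsManifold I ∞ M] (g : Metric I M) (D D' : LinearConnection I M) : Prop where
  smooth_left : IsSmoothConnection D
  smooth_right : IsSmoothConnection D'
  duality : ∀ X Y Z : Field I M, IsSmoothField X → IsSmoothField Y → IsSmoothField Z → ∀ x,
    lieDeriv X (pair g.inner Y Z) x =
      pair g.inner (along D X Y) Z x + pair g.inner Y (along D' X Z) x

/-- Statistical connections on `(M, g)`: dual connections both of which are torsion-free. -/
structure IsStatistical [IsManifold I ∞ M] [FiniteDimensional ℝ E] [CompleteSpace E]
    (g : Metric I M) (D D' : LinearConnection I M) : Prop where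
  dual : IsDual g D D'
  torsionFree_left : IsTorsionFree D
  torsionFree_right : IsTorsionFree D'

/-- The pairs `(∇, ∇*)` consisting of a symplectic connection of `(M, Ω)` and its `g`-dual. -/
def symplecticDualPairs [IsManifold I ∞ M] [FiniteDimensional ℝ E] [CompleteSpace E]
    (Ω : BilinField I M) (g : Metric I M) : Set (LinearConnection I M × LinearConnection I M) :=
  {p | IsSymplecticConnection Ω p.1 ∧ IsDual g p.1 p.2}

/-- `(M, Ω, Θ, g)` is statistical almost Kähler: it is almost Kähler, and some symplectic connection
forms with its `g`-dual a pair of statistical connections. -/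
structure IsStatisticalAlmostKahler [IsManifold I ∞ M] [FiniteDimensional ℝ E] [CompleteSpace E]
    (Ω : BilinField I M) (Θ : EndField I M) (g : Metric I M) : Prop where
  almostKahler : IsAlmostKahler Ω Θ g
  exists_statistical : ∃ p ∈ symplecticDualPairs Ω g, IsStatistical g p.1 p.2

/-- `g` is a Hermitian metric of the symplectic manifold `(M, Ω)`: it is the metric of an almost
Kähler structure `(Ω, Θ, g)`. -/
def IsHermitianMetric [IsManifold I ∞ M] (Ω : BilinField I M) (g : Metric I M) : Prop :=
  ∃ Θ : EndField I M, IsAlmostKahler Ω Θ g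

/-- `g` is a Kähler metric of the symplectic manifold `(M, Ω)`: it is the metric of a Kähler
structure `(Ω, Θ, g)`. -/
def IsKahlerMetric [IsManifold I ∞ M] (Ω : BilinField I M) (g : Metric I M) : Prop :=
  ∃ Θ : EndField I M, IsKahler Ω Θ g

end AlmostKahlerGeometry

end

namespace AlmostKahlerGeometry

section Pairing

variable {E : Type*} [NormedAddCommGroup E] [NormedSpace ℝ E]
  {H : Type*} [TopologicalSpace H] {I : ModelWithCorners ℝ E H}
  {M : Type*} [TopologicalSpace M] [ChartedSpace H M] {x : M}

lemma pair_comm {b : BilinField I M} (hb : ∀ x v w, b x v w = b x w v) (X Y : Field I M) :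
    pair b X Y = pair b Y X :=
  funext fun x ↦ hb x _ _

lemma pair_smul_left (b : BilinField I M) (f : M → ℝ) (X Y : Field I M) :
    pair b (f • X) Y = f * pair b X Y := by
  funext x; simp [pair]

lemma pair_smul_right (b : BilinField I M) (f : M → ℝ) (X Y : Field I M) :
    pair b X (f • Y) = f * pair b X Y := by
  funext x; simp [pair]

lemma pair_add_left (b : BilinField I M) (X X' Y : Field I M) :
    pair b (X + X') Y = pair b X Y + pair b X' Y := by
  funext x; simp [pair]

lemma pair_add_right (b : BilinField I M) (X Y Y' : Field I M) :
    pair b X (Y + Y') = pair b X Y + pair b X Y' := by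
  funext x; simp [pair]

lemma lieDeriv_smul_field (f h : M → ℝ) (X : Field I M) :
    lieDeriv (f • X) h x = f x * lieDeriv X h x := by
  simp [lieDeriv]

lemma lieDeriv_add_field (h : M → ℝ) (X X' : Field I M) :
    lieDeriv (X + X') h x = lieDeriv X h x + lieDeriv X' h x := by
  simp [lieDeriv]

lemma lieDeriv_mul {f h : M → ℝ} (X : Field I M) (hf : MDifferentiableAt I 𝓘(ℝ, ℝ) f x)
    (hh : MDifferentiableAt I 𝓘(ℝ, ℝ) h x) :
    lieDeriv X (f * h) x = f x * lieDeriv X h x + h x * lieDeriv X f x := by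
  simp [lieDeriv, mvfderiv_mul hf hh]

lemma lieDeriv_add {f h : M → ℝ} (X : Field I M) (hf : MDifferentiableAt I 𝓘(ℝ, ℝ) f x)
    (hh : MDifferentiableAt I 𝓘(ℝ, ℝ) h x) :
    lieDeriv X (f + h) x = lieDeriv X f x + lieDeriv X h x := by
  simp [lieDeriv, mvfderiv_add hf hh]

lemma lieDeriv_neg (f : M → ℝ) (X : Field I M) :
    lieDeriv X (-f) x = -lieDeriv X f x := by
  simp [lieDeriv, mvfderiv_neg]

variable [IsManifold I ∞ M]

lemma contMDiffAt_pair {b : BilinField I M} (hb : IsSmoothBilin b) {X Y : Field I M}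
    (hX : CMDiffAt ∞ (T% X) x) (hY : CMDiffAt ∞ (T% Y) x) :
    ContMDiffAt I 𝓘(ℝ, ℝ) ∞ (pair b X Y) x := by
  have : ContMDiffAt I (I.prod 𝓘(ℝ)) ∞
      (fun m ↦ TotalSpace.mk' ℝ (E := Bundle.Trivial M ℝ) m (b m (X m) (Y m))) x :=
    ContMDiffAt.clm_bundle_apply₂ (F₁ := E) (F₂ := E) (hb x) hX hY
  exact (contMDiffAt_totalSpace.1 this).2

lemma mdifferentiableAt_pair {b : BilinField I M} (hb : IsSmoothBilin b) {X Y : Field I M}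
    (hX : MDiffAt (T% X) x) (hY : MDiffAt (T% Y) x) :
    MDifferentiableAt I 𝓘(ℝ, ℝ) (pair b X Y) x := by
  have : MDifferentiableAt I (I.prod 𝓘(ℝ))
      (fun m ↦ TotalSpace.mk' ℝ (E := Bundle.Trivial M ℝ) m (b m (X m) (Y m))) x :=
    MDifferentiableAt.clm_bundle_apply₂ (F₁ := E) (F₂ := E)
      ((hb x).mdifferentiableAt (by simp)) hX hY
  exact ((mdifferentiableAt_totalSpace ..).1 this).2

lemma contMDiffAt_lieDeriv {f : M → ℝ} (hf : ContMDiffAt I 𝓘(ℝ, ℝ) ∞ f x) {X : Field I M}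
    (hX : CMDiffAt ∞ (T% X) x) : ContMDiffAt I 𝓘(ℝ, ℝ) ∞ (lieDeriv X f) x := by
  have h := (hf.mfderiv_const (m := ∞) (by simp)).clm_apply_of_inCoordinates hX hf
  have := (contMDiffAt_totalSpace.1 h).2
  simpa [lieDeriv, mvfderiv] using! this

lemma IsSmoothField.mdiffAt {X : Field I M} (hX : IsSmoothField X) (x : M) : MDiffAt (T% X) x :=
  (hX x).mdifferentiableAt (by simp)

lemma IsSmoothField.act {A : EndField I M} (hA : IsSmoothEnd A) {X : Field I M}
    (hX : IsSmoothField X) : IsSmoothField (act A X) :=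
  ContMDiff.clm_bundle_apply (F₁ := E) (F₂ := E) hA hX

lemma contMDiffAt_mlieBracket [CompleteSpace E] {X Y : Field I M}
    (hX : CMDiffAt ∞ (T% X) x) (hY : CMDiffAt ∞ (T% Y) x) :
    CMDiffAt ∞ (T% (VectorField.mlieBracket I X Y)) x := by
  have : IsManifold I (∞ + 1) M := by rwa [show (∞ + 1 : ℕ∞ω) = ∞ from rfl]
  have : IsManifold I (minSmoothness ℝ 3) M := by
    rw [minSmoothness_of_isRCLikeNormedField]; infer_instance
  exact ContMDiffAt.mlieBracket_vectorField (m := ⊤) (n := ⊤) hX hY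
    (by rw [minSmoothness_of_isRCLikeNormedField]; simp)

lemma exists_isSmoothField_eq [FiniteDimensional ℝ E] [T2Space M] (x : M) (v : TangentSpace I x) :
    ∃ X : Field I M, IsSmoothField X ∧ X x = v := by
  let Z : Field I M := FiberBundle.extend E v
  obtain ⟨s, hs, hZ⟩ := FiberBundle.exists_contMDiffOn_extend (k := ∞) I E v
  obtain ⟨u, hus, hu, hxu⟩ := mem_nhds_iff.1 hs
  obtain ⟨φ, -, hφ⟩ :=
    (SmoothBumpFunction.nhds_basis_tsupport (I := I) x).mem_iff.1 (hu.mem_nhds hxu)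
  refine ⟨(φ : M → ℝ) • Z, ContMDiffOn.smul_section_of_tsupport φ.contMDiff.contMDiffOn hu hφ
    (hZ.mono hus), ?_⟩
  simp [Z]

end Pairing

section Frame

variable {E : Type*} [NormedAddCommGroup E] [NormedSpace ℝ E] [FiniteDimensional ℝ E]
  {H : Type*} [TopologicalSpace H] {I : ModelWithCorners ℝ E H}
  {M : Type*} [TopologicalSpace M] [ChartedSpace H M] [IsManifold I ∞ M]
  {F : Type*} [NormedAddCommGroup F] [NormedSpace ℝ F] {W : M → Type*}
  [TopologicalSpace (TotalSpace F W)] [∀ x, AddCommGroup (W x)] [∀ x, Module ℝ (W x)]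
  [∀ x, TopologicalSpace (W x)] [∀ x, IsTopologicalAddGroup (W x)] [∀ x, ContinuousSMul ℝ (W x)]
  [FiberBundle F W] [VectorBundle ℝ F W]

/-- A section of `Hom(TM, W)` is smooth at a point if its values on smooth vector fields are. -/
lemma contMDiffAt_hom_of_apply {φ : Π x : M, TangentSpace I x →L[ℝ] W x} {x₀ : M}
    (h : ∀ X : Field I M, CMDiffAt ∞ (T% X) x₀ →
      CMDiffAt ∞ (fun x ↦ TotalSpace.mk' F x (φ x (X x))) x₀) :
    CMDiffAt ∞ (fun x ↦ TotalSpace.mk' (E →L[ℝ] F) (E := fun x ↦ TangentSpace I x →L[ℝ] W x)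
      x (φ x)) x₀ := by
  let e := trivializationAt E (TangentSpace I : M → Type _) x₀
  have hx₀ : x₀ ∈ e.baseSet := FiberBundle.mem_baseSet_trivializationAt' x₀
  let e' := trivializationAt F W x₀
  have hx₀' : x₀ ∈ e'.baseSet := FiberBundle.mem_baseSet_trivializationAt' x₀
  let b := Module.finBasis ℝ E
  rw [contMDiffAt_hom_bundle]
  refine ⟨contMDiffAt_id, ?_⟩
  have key : CMDiffAt ∞ (fun x ↦ ∑ i, (LinearMap.toContinuousLinearMap (b.coord i)).smulRight
      (e' ⟨x, φ x (e.localFrame b i x)⟩).2) x₀ := by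
    refine ContMDiffAt.sum fun i _ ↦ ?_
    have h1 := (contMDiffAt_section _).1 (h _ (contMDiffAt_localFrame_of_mem ∞ e b i hx₀))
    exact ((ContinuousLinearMap.smulRightL ℝ E F
      (LinearMap.toContinuousLinearMap (b.coord i))).contMDiff.contMDiffAt).comp x₀ h1
  refine key.congr_of_eventuallyEq ?_
  filter_upwards [e.open_baseSet.mem_nhds hx₀, e'.open_baseSet.mem_nhds hx₀'] with x hx hx'
  apply ContinuousLinearMap.coe_injective
  refine b.ext fun j ↦ ?_
  rw [ContinuousLinearMap.inCoordinates_eq hx hx']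
  simp [Finsupp.single_apply, e', e.localFrame_apply_of_mem_baseSet b hx, Trivialization.basisAt, e]

end Frame

section Inverse

variable {E : Type*} [NormedAddCommGroup E] [NormedSpace ℝ E]
  {H : Type*} [TopologicalSpace H] {I : ModelWithCorners ℝ E H}
  {M : Type*} [TopologicalSpace M] [ChartedSpace H M]
  {F : Type*} [NormedAddCommGroup F] [NormedSpace ℝ F] {V : M → Type*}
  [TopologicalSpace (TotalSpace F V)] [∀ x, AddCommGroup (V x)] [∀ x, Module ℝ (V x)]
  [∀ x, TopologicalSpace (V x)] [∀ x, IsTopologicalAddGroup (V x)] [∀ x, ContinuousSMul ℝ (V x)]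
  [FiberBundle F V] [VectorBundle ℝ F V]
  {F' : Type*} [NormedAddCommGroup F'] [NormedSpace ℝ F'] {W : M → Type*}
  [TopologicalSpace (TotalSpace F' W)] [∀ x, AddCommGroup (W x)] [∀ x, Module ℝ (W x)]
  [∀ x, TopologicalSpace (W x)] [∀ x, IsTopologicalAddGroup (W x)] [∀ x, ContinuousSMul ℝ (W x)]
  [FiberBundle F' W] [VectorBundle ℝ F' W]

/-- The fibrewise inverse of a smooth family of invertible linear maps is smooth. -/
lemma contMDiffAt_hom_inverse [CompleteSpace F] {n : ℕ∞ω} {φ : Π x : M, V x →L[ℝ] W x} {x₀ : M}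
    (hφ : CMDiffAt n (fun x ↦ TotalSpace.mk' (F →L[ℝ] F') (E := fun x ↦ V x →L[ℝ] W x)
      x (φ x)) x₀) (hinv : ∀ x, (φ x).IsInvertible) :
    CMDiffAt n (fun x ↦ TotalSpace.mk' (F' →L[ℝ] F) (E := fun x ↦ W x →L[ℝ] V x)
      x (φ x).inverse) x₀ := by
  have hx₀ := FiberBundle.mem_baseSet_trivializationAt' (F := F) (E := V) x₀
  have hx₀' := FiberBundle.mem_baseSet_trivializationAt' (F := F') (E := W) x₀
  rw [contMDiffAt_hom_bundle] at hφ ⊢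
  refine ⟨contMDiffAt_id, ?_⟩
  have hinv₀ : (ContinuousLinearMap.inCoordinates F V F' W x₀ x₀ x₀ x₀ (φ x₀)).IsInvertible := by
    obtain ⟨L, hL⟩ := hinv x₀
    rw [ContinuousLinearMap.inCoordinates_eq hx₀ hx₀', ← hL]
    exact ⟨((((trivializationAt F V x₀).continuousLinearEquivAt ℝ x₀ hx₀).symm.trans L).trans
      ((trivializationAt F' W x₀).continuousLinearEquivAt ℝ x₀ hx₀')), rfl⟩
  refine ((hinv₀.contDiffAt_map_inverse (n := n)).contMDiffAt.comp x₀ hφ.2).congr_of_eventuallyEq ?_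
  filter_upwards [(trivializationAt F V x₀).open_baseSet.mem_nhds hx₀,
    (trivializationAt F' W x₀).open_baseSet.mem_nhds hx₀'] with x hx hx'
  obtain ⟨L, hL⟩ := hinv x
  simp only [Function.comp_apply]
  rw [ContinuousLinearMap.inCoordinates_eq hx hx', ContinuousLinearMap.inCoordinates_eq hx' hx,
    ← hL, ContinuousLinearMap.inverse_equiv]
  exact (ContinuousLinearMap.inverse_equiv
    (((((trivializationAt F V x₀).continuousLinearEquivAt ℝ x hx).symm.trans L).trans
      ((trivializationAt F' W x₀).continuousLinearEquivAt ℝ x hx')))).symm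

end Inverse

section Musical

variable {E : Type*} [NormedAddCommGroup E] [NormedSpace ℝ E] [FiniteDimensional ℝ E]
  {H : Type*} [TopologicalSpace H] {I : ModelWithCorners ℝ E H}
  {M : Type*} [TopologicalSpace M] [ChartedSpace H M] [IsManifold I ∞ M]

omit [FiniteDimensional ℝ E] in
lemma Metric.eq_of_forall_inner (g : Metric I M) {x : M} {v w : TangentSpace I x}
    (h : ∀ u, g.inner x v u = g.inner x w u) : v = w := by
  by_contra hne
  have := g.pos x (v - w) (sub_ne_zero.2 hne)
  simp [h] at this

lemma Metric.isInvertible_inner (g : Metric I M) (x : M) : (g.inner x).IsInvertible := by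
  have : FiniteDimensional ℝ (TangentSpace I x) := inferInstanceAs (FiniteDimensional ℝ E)
  have : T2Space (TangentSpace I x) := inferInstanceAs (T2Space E)
  have hinj : Function.Injective (g.inner x).toLinearMap := fun v w h ↦
    g.eq_of_forall_inner fun u ↦ by simpa using congr($h u)
  have hrank : Module.finrank ℝ (TangentSpace I x) = Module.finrank ℝ (TangentSpace I x →L[ℝ] ℝ) :=
    (Subspace.dual_finrank_eq (K := ℝ) (V := TangentSpace I x)).symm.trans
      (LinearMap.toContinuousLinearMap (E := TangentSpace I x) (F' := ℝ)).finrank_eq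
  exact ⟨(LinearEquiv.ofInjectiveOfFinrankEq (g.inner x).toLinearMap hinj hrank
    ).toContinuousLinearEquiv, by ext; rfl⟩

/-- A vector field is smooth at a point if its scalar products with smooth fields are. -/
lemma contMDiffAt_of_inner (g : Metric I M) {Y : Field I M} {x₀ : M}
    (h : ∀ X : Field I M, CMDiffAt ∞ (T% X) x₀ →
      ContMDiffAt I 𝓘(ℝ, ℝ) ∞ (pair g.inner Y X) x₀) : CMDiffAt ∞ (T% Y) x₀ := by
  have hα : CMDiffAt ∞ (fun x ↦ TotalSpace.mk' (E →L[ℝ] ℝ)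
      (E := fun x ↦ TangentSpace I x →L[ℝ] Bundle.Trivial M ℝ x) x (g.inner x (Y x))) x₀ :=
    contMDiffAt_hom_of_apply fun X hX ↦ contMDiffAt_totalSpace.2 ⟨contMDiffAt_id, h X hX⟩
  have hg : CMDiffAt ∞ (fun x ↦ TotalSpace.mk' (E →L[ℝ] E →L[ℝ] ℝ)
      (E := fun x ↦ TangentSpace I x →L[ℝ] TangentSpace I x →L[ℝ] Bundle.Trivial M ℝ x)
      x (g.inner x)) x₀ := g.contMDiff x₀
  have := (contMDiffAt_hom_inverse hg g.isInvertible_inner).clm_bundle_apply hα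
  simpa [(g.isInvertible_inner _).inverse_apply_self] using! this

end Musical

section Koszul

variable {E : Type*} [NormedAddCommGroup E] [NormedSpace ℝ E]
  {H : Type*} [TopologicalSpace H] {I : ModelWithCorners ℝ E H}
  {M : Type*} [TopologicalSpace M] [ChartedSpace H M] {x : M}

/-- The right-hand side of the Koszul formula for `2 g(∇_X Y, Z)`. -/
noncomputable def koszul (b : BilinField I M) (X Y Z : Field I M) (x : M) : ℝ :=
  lieDeriv X (pair b Y Z) x + lieDeriv Y (pair b X Z) x - lieDeriv Z (pair b X Y) x
    + pair b (VectorField.mlieBracket I X Y) Z x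
    - pair b (VectorField.mlieBracket I X Z) Y x
    - pair b (VectorField.mlieBracket I Y Z) X x

lemma lieDeriv_apply (f : M → ℝ) (X : Field I M) : mvfderiv I f x (X x) = lieDeriv X f x := rfl

variable [IsManifold I ∞ M] [CompleteSpace E] {b : BilinField I M}

lemma koszul_smul_left (hb : IsSmoothBilin b) (hs : ∀ x v w, b x v w = b x w v)
    {f : M → ℝ} {X Y Z : Field I M} (hf : MDifferentiableAt I 𝓘(ℝ, ℝ) f x)
    (hX : MDiffAt (T% X) x) (hY : MDiffAt (T% Y) x) (hZ : MDiffAt (T% Z) x) :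
    koszul b (f • X) Y Z x = f x * koszul b X Y Z x := by
  simp only [koszul, pair_smul_left, pair_smul_right, lieDeriv_smul_field, Pi.mul_apply,
    lieDeriv_mul _ hf (mdifferentiableAt_pair hb hX hZ),
    lieDeriv_mul _ hf (mdifferentiableAt_pair hb hX hY)]
  simp only [pair, VectorField.mlieBracket_smul_left hf hX, map_add, map_smul, neg_smul, map_neg,
    lieDeriv_apply, add_apply, neg_apply, smul_apply, smul_eq_mul, hs x (X x) (Y x)]
  rw [hs x (X x) (Z x)]
  ring

lemma koszul_smul_right (hb : IsSmoothBilin b) (hs : ∀ x v w, b x v w = b x w v)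
    {f : M → ℝ} {X Y Z : Field I M} (hf : MDifferentiableAt I 𝓘(ℝ, ℝ) f x)
    (hX : MDiffAt (T% X) x) (hY : MDiffAt (T% Y) x) (hZ : MDiffAt (T% Z) x) :
    koszul b X Y (f • Z) x = f x * koszul b X Y Z x := by
  simp only [koszul, pair_smul_right, lieDeriv_smul_field, Pi.mul_apply,
    lieDeriv_mul _ hf (mdifferentiableAt_pair hb hX hZ),
    lieDeriv_mul _ hf (mdifferentiableAt_pair hb hY hZ)]
  simp only [pair, VectorField.mlieBracket_smul_right hf hZ, map_add, map_smul,
    lieDeriv_apply, add_apply, smul_apply, smul_eq_mul]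
  rw [hs x (Z x) (Y x), hs x (Z x) (X x)]
  ring

lemma koszul_smul_middle (hb : IsSmoothBilin b) (hs : ∀ x v w, b x v w = b x w v)
    {f : M → ℝ} {X Y Z : Field I M} (hf : MDifferentiableAt I 𝓘(ℝ, ℝ) f x)
    (hX : MDiffAt (T% X) x) (hY : MDiffAt (T% Y) x) (hZ : MDiffAt (T% Z) x) :
    koszul b X (f • Y) Z x = f x * koszul b X Y Z x + 2 * (lieDeriv X f x * b x (Y x) (Z x)) := by
  simp only [koszul, pair_smul_left, pair_smul_right, lieDeriv_smul_field, Pi.mul_apply,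
    lieDeriv_mul _ hf (mdifferentiableAt_pair hb hY hZ),
    lieDeriv_mul _ hf (mdifferentiableAt_pair hb hX hY)]
  simp only [pair, VectorField.mlieBracket_smul_left hf hY,
    VectorField.mlieBracket_smul_right hf hY, map_add, map_smul, neg_smul, map_neg,
    lieDeriv_apply, add_apply, neg_apply, smul_apply, smul_eq_mul]
  rw [hs x (Y x) (X x)]
  ring

lemma koszul_add_left (hb : IsSmoothBilin b) {X X' Y Z : Field I M}
    (hX : MDiffAt (T% X) x) (hX' : MDiffAt (T% X') x) (hY : MDiffAt (T% Y) x)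
    (hZ : MDiffAt (T% Z) x) :
    koszul b (X + X') Y Z x = koszul b X Y Z x + koszul b X' Y Z x := by
  simp only [koszul, pair_add_left, pair_add_right, lieDeriv_add_field, Pi.add_apply,
    lieDeriv_add _ (mdifferentiableAt_pair hb hX hZ) (mdifferentiableAt_pair hb hX' hZ),
    lieDeriv_add _ (mdifferentiableAt_pair hb hX hY) (mdifferentiableAt_pair hb hX' hY)]
  simp only [pair, VectorField.mlieBracket_add_left hX hX', map_add, add_apply]
  ring

lemma koszul_add_right (hb : IsSmoothBilin b) {X Y Z Z' : Field I M}
    (hX : MDiffAt (T% X) x) (hY : MDiffAt (T% Y) x)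
    (hZ : MDiffAt (T% Z) x) (hZ' : MDiffAt (T% Z') x) :
    koszul b X Y (Z + Z') x = koszul b X Y Z x + koszul b X Y Z' x := by
  simp only [koszul, pair_add_right, lieDeriv_add_field, Pi.add_apply,
    lieDeriv_add _ (mdifferentiableAt_pair hb hY hZ) (mdifferentiableAt_pair hb hY hZ'),
    lieDeriv_add _ (mdifferentiableAt_pair hb hX hZ) (mdifferentiableAt_pair hb hX hZ')]
  simp only [pair, VectorField.mlieBracket_add_right hZ hZ', map_add, add_apply]
  ring

lemma koszul_add_middle (hb : IsSmoothBilin b) {X Y Y' Z : Field I M}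
    (hX : MDiffAt (T% X) x) (hY : MDiffAt (T% Y) x) (hY' : MDiffAt (T% Y') x)
    (hZ : MDiffAt (T% Z) x) :
    koszul b X (Y + Y') Z x = koszul b X Y Z x + koszul b X Y' Z x := by
  simp only [koszul, pair_add_left, pair_add_right, lieDeriv_add_field, Pi.add_apply,
    lieDeriv_add _ (mdifferentiableAt_pair hb hY hZ) (mdifferentiableAt_pair hb hY' hZ),
    lieDeriv_add _ (mdifferentiableAt_pair hb hX hY) (mdifferentiableAt_pair hb hX hY')]
  simp only [pair, VectorField.mlieBracket_add_left hY hY',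
    VectorField.mlieBracket_add_right hY hY', map_add, add_apply]
  ring

lemma contMDiffAt_koszul (hb : IsSmoothBilin b) {X Y Z : Field I M}
    (hX : CMDiffAt ∞ (T% X) x) (hY : CMDiffAt ∞ (T% Y) x) (hZ : CMDiffAt ∞ (T% Z) x) :
    ContMDiffAt I 𝓘(ℝ, ℝ) ∞ (koszul b X Y Z) x :=
  (((((contMDiffAt_lieDeriv (contMDiffAt_pair hb hY hZ) hX).add
    (contMDiffAt_lieDeriv (contMDiffAt_pair hb hX hZ) hY)).sub
    (contMDiffAt_lieDeriv (contMDiffAt_pair hb hX hY) hZ)).add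
    (contMDiffAt_pair hb (contMDiffAt_mlieBracket hX hY) hZ)).sub
    (contMDiffAt_pair hb (contMDiffAt_mlieBracket hX hZ) hY)).sub
    (contMDiffAt_pair hb (contMDiffAt_mlieBracket hY hZ) hX)

end Koszul

section LeviCivita

variable {E : Type*} [NormedAddCommGroup E] [NormedSpace ℝ E] [FiniteDimensional ℝ E]
  [CompleteSpace E]
  {H : Type*} [TopologicalSpace H] {I : ModelWithCorners ℝ E H}
  {M : Type*} [TopologicalSpace M] [ChartedSpace H M] [IsManifold I ∞ M] {x : M}

/-- The bilinear form `(v, w) ↦ 2 g(∇_v Y, w)` given by the Koszul formula. -/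
noncomputable def koszulForm (g : Metric I M) (Y : Field I M) (x : M) (hY : MDiffAt (T% Y) x) :
    TangentSpace I x →L[ℝ] TangentSpace I x →L[ℝ] ℝ :=
  TensorialAt.mkHom₂ (I := I) (F := E) (F' := E) (fun X Z ↦ koszul g.inner X Y Z x) x
    (fun _ hZ ↦ ⟨fun hf hX ↦ koszul_smul_left g.contMDiff g.symm hf hX hY hZ,
      fun hX hX' ↦ koszul_add_left g.contMDiff hX hX' hY hZ⟩)
    (fun _ hX ↦ ⟨fun hf hZ ↦ koszul_smul_right g.contMDiff g.symm hf hX hY hZ,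
      fun hZ hZ' ↦ koszul_add_right g.contMDiff hX hY hZ hZ'⟩)

lemma koszulForm_apply (g : Metric I M) {X Y Z : Field I M} (hX : MDiffAt (T% X) x)
    (hY : MDiffAt (T% Y) x) (hZ : MDiffAt (T% Z) x) :
    koszulForm g Y x hY (X x) (Z x) = koszul g.inner X Y Z x :=
  TensorialAt.mkHom₂_apply _ _ hX hZ

open Classical in
/-- The covariant derivative defined by the Koszul formula, as an operation on vector fields. -/
noncomputable def leviCivitaFun (g : Metric I M) (Y : Field I M) (x : M) :
    TangentSpace I x →L[ℝ] TangentSpace I x :=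
  if hY : MDiffAt (T% Y) x then (g.inner x).inverse ∘L ((1 / 2 : ℝ) • koszulForm g Y x hY) else 0

lemma inner_leviCivitaFun (g : Metric I M) {X Y Z : Field I M} (hX : MDiffAt (T% X) x)
    (hY : MDiffAt (T% Y) x) (hZ : MDiffAt (T% Z) x) :
    g.inner x (leviCivitaFun g Y x (X x)) (Z x) = 1 / 2 * koszul g.inner X Y Z x := by
  rw [leviCivitaFun, dif_pos hY, ContinuousLinearMap.comp_apply,
    (g.isInvertible_inner x).self_apply_inverse, ← koszulForm_apply g hX hY hZ]
  simp

omit [FiniteDimensional ℝ E] [CompleteSpace E] in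
/-- Two endomorphisms of a tangent space agree if their matrix coefficients on differentiable
vector fields agree. -/
lemma Metric.clm_ext (g : Metric I M) {A B : TangentSpace I x →L[ℝ] TangentSpace I x}
    (h : ∀ X Z : Field I M, MDiffAt (T% X) x → MDiffAt (T% Z) x →
      g.inner x (A (X x)) (Z x) = g.inner x (B (X x)) (Z x)) : A = B := by
  ext v
  refine g.eq_of_forall_inner fun u ↦ ?_
  simpa using h (FiberBundle.extend E v) (FiberBundle.extend E u)
    (FiberBundle.mdifferentiableAt_extend ..) (FiberBundle.mdifferentiableAt_extend ..)

/-- The Levi-Civita connection. -/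
noncomputable def leviCivita (g : Metric I M) : LinearConnection I M where
  toFun := leviCivitaFun g
  isCovariantDerivativeOnUniv :=
    { add := fun {Y Y' x} hY hY' _ ↦ g.clm_ext fun X Z hX hZ ↦ by
        rw [inner_leviCivitaFun g hX (mdifferentiableAt_add_section hY hY') hZ, add_apply, map_add,
          add_apply, inner_leviCivitaFun g hX hY hZ, inner_leviCivitaFun g hX hY' hZ,
          koszul_add_middle g.contMDiff hX hY hY' hZ, mul_add]
      leibniz := fun {Y f x} hY hf _ ↦ g.clm_ext fun X Z hX hZ ↦ by
        rw [inner_leviCivitaFun g hX (hf.smul_section hY) hZ,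
          koszul_smul_middle g.contMDiff g.symm hf hX hY hZ, add_apply, map_add,
          add_apply, smul_apply, map_smul, smul_apply, inner_leviCivitaFun g hX hY hZ,
          ContinuousLinearMap.smulRight_apply, map_smul, smul_apply, lieDeriv_apply,
          smul_eq_mul, smul_eq_mul]
        ring }

lemma inner_leviCivita (g : Metric I M) {X Y Z : Field I M} (hX : MDiffAt (T% X) x)
    (hY : MDiffAt (T% Y) x) (hZ : MDiffAt (T% Z) x) :
    g.inner x (leviCivita g Y x (X x)) (Z x) = 1 / 2 * koszul g.inner X Y Z x :=
  inner_leviCivitaFun g hX hY hZ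

lemma isSmoothConnection_leviCivita (g : Metric I M) : IsSmoothConnection (leviCivita g) := by
  refine ⟨⟨fun {Y} hY ↦ fun x _ ↦ ContMDiffAt.contMDiffWithinAt ?_⟩⟩
  have hY' : IsSmoothField Y := contMDiffOn_univ.1 hY
  refine contMDiffAt_hom_of_apply fun X hX ↦ contMDiffAt_of_inner g fun Z hZ ↦ ?_
  have hk : ContMDiffAt I 𝓘(ℝ, ℝ) ∞ (fun x ↦ 1 / 2 * koszul g.inner X Y Z x) x :=
    contMDiffAt_const.mul (contMDiffAt_koszul g.contMDiff hX (hY' x) hZ)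
  refine hk.congr_of_eventuallyEq ?_
  filter_upwards [(contMDiffAt_iff_contMDiffAt_nhds (by simp)).1 (hX.of_le (m := 1) (by simp)),
    (contMDiffAt_iff_contMDiffAt_nhds (by simp)).1 (hZ.of_le (m := 1) (by simp))] with y hXy hZy
  exact inner_leviCivita g (hXy.mdifferentiableAt (by simp)) (hY'.mdiffAt y)
    (hZy.mdifferentiableAt (by simp))

lemma isTorsionFree_leviCivita (g : Metric I M) : IsTorsionFree (leviCivita g) := by
  refine (CovariantDerivative.torsion_eq_zero_iff _).2 fun {X Y x} hX hY ↦ ?_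
  refine g.eq_of_forall_inner fun u ↦ ?_
  have hZ : MDiffAt (T% (FiberBundle.extend E u)) x := FiberBundle.mdifferentiableAt_extend I E u
  have h1 := inner_leviCivita g hX hY hZ
  have h2 := inner_leviCivita g hY hX hZ
  simp only [FiberBundle.extend_apply_self] at h1 h2
  rw [map_sub, sub_apply, h1, h2, koszul, koszul, pair_comm g.symm Y X,
    VectorField.mlieBracket_swap (V := Y) (W := X)]
  simp [pair]
  ring

lemma lieDeriv_inner_eq_leviCivita (g : Metric I M) {X Y Z : Field I M}
    (hX : MDiffAt (T% X) x) (hY : MDiffAt (T% Y) x) (hZ : MDiffAt (T% Z) x) :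
    lieDeriv X (pair g.inner Y Z) x =
      pair g.inner (along (leviCivita g) X Y) Z x + pair g.inner Y (along (leviCivita g) X Z) x := by
  have h1 := inner_leviCivita g hX hY hZ
  have h2 := inner_leviCivita g hX hZ hY
  simp only [pair, along]
  rw [g.symm x (Y x), h1, h2, koszul, koszul, pair_comm g.symm Z Y,
    VectorField.mlieBracket_swap (V := Z) (W := Y)]
  simp [pair]
  ring

lemma isDual_leviCivita (g : Metric I M) : IsDual g (leviCivita g) (leviCivita g) where
  smooth_left := isSmoothConnection_leviCivita g
  smooth_right := isSmoothConnection_leviCivita g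
  duality _ _ _ hX hY hZ x :=
    lieDeriv_inner_eq_leviCivita g (hX.mdiffAt x) (hY.mdiffAt x) (hZ.mdiffAt x)

end LeviCivita

section Kahler

variable {E : Type*} [NormedAddCommGroup E] [NormedSpace ℝ E]
  {H : Type*} [TopologicalSpace H] {I : ModelWithCorners ℝ E H}
  {M : Type*} [TopologicalSpace M] [ChartedSpace H M] [IsManifold I ∞ M] {x : M}
  {Ω : BilinField I M} {Θ : EndField I M} {g : Metric I M}

namespace IsAlmostKahler

lemma inner_act_left (h : IsAlmostKahler Ω Θ g) (v w : TangentSpace I x) :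
    g.inner x (Θ x v) w = -g.inner x v (Θ x w) := by
  rw [← h.hermitian x v (Θ x w), h.almostComplex.sq]
  simp

lemma omega_eq (h : IsAlmostKahler Ω Θ g) (v w : TangentSpace I x) :
    Ω x v w = -g.inner x v (Θ x w) := by
  rw [h.fundamental, h.inner_act_left]

lemma inner_eq_omega (h : IsAlmostKahler Ω Θ g) (v w : TangentSpace I x) :
    g.inner x v w = Ω x v (Θ x w) := by
  rw [h.omega_eq, h.almostComplex.sq]
  simp

end IsAlmostKahler

/-- On a Kähler manifold the Levi-Civita connection commutes with the complex structure,
in terms of the Koszul formula. -/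
lemma IsKahler.koszul_act_add_koszul_act (h : IsKahler Ω Θ g) {X Y Z : Field I M}
    (hX : IsSmoothField X) (hY : IsSmoothField Y) (hZ : IsSmoothField Z) (x : M) :
    koszul g.inner X (act Θ Y) Z x + koszul g.inner X Y (act Θ Z) x = 0 := by
  have hK := h.almostKahler
  have hΘ := hK.almostComplex.smooth
  have hsq := hK.almostComplex.sq
  have d1 := hK.symplectic.closed X Y Z hX hY hZ x
  have d2 := hK.symplectic.closed X (act Θ Y) (act Θ Z) hX (hY.act hΘ) (hZ.act hΘ) x
  have hN := congr(g.inner x $(h.integrable Y Z hY hZ x) (Θ x (X x)))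
  have e1 : pair Ω Y Z = -pair g.inner Y (act Θ Z) := funext fun y ↦ hK.omega_eq _ _
  have e2 : pair g.inner (act Θ Y) Z = -pair g.inner Y (act Θ Z) :=
    funext fun y ↦ hK.inner_act_left _ _
  have e3 : pair Ω (act Θ Y) (act Θ Z) = -pair g.inner Y (act Θ Z) := funext fun y ↦ by
    simp [pair, act, hK.omega_eq, hsq, hK.inner_act_left]
  have e4 : pair Ω (act Θ Z) X = -pair g.inner X Z := funext fun y ↦ by
    simp [pair, act, hK.omega_eq, hK.hermitian, g.symm y (X y)]
  have e5 : pair Ω X Y = -pair g.inner X (act Θ Y) := funext fun y ↦ hK.omega_eq _ _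
  have e6 : pair Ω Z X = pair g.inner X (act Θ Z) := funext fun y ↦ by
    simp [pair, act, hK.fundamental, g.symm y (X y)]
  have e7 : pair Ω X (act Θ Y) = pair g.inner X Y := funext fun y ↦ (hK.inner_eq_omega _ _).symm
  rw [extDerivTwoForm, e1, e5, e6, VectorField.mlieBracket_swap (V := Z) (W := X)] at d1
  rw [extDerivTwoForm, e3, e4, e7, VectorField.mlieBracket_swap (V := act Θ Z) (W := X)] at d2
  rw [koszul, koszul, e2]
  simp only [nijenhuis, lieDeriv_neg, pair, act, hK.omega_eq, hsq, hK.hermitian, map_sub, map_neg,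
    sub_apply, Pi.neg_apply, neg_apply, map_zero, zero_apply, neg_neg] at d1 d2 hN ⊢
  linear_combination d1 - d2 + hN

variable [FiniteDimensional ℝ E] [CompleteSpace E]

lemma IsKahler.isSymplecticConnection_leviCivita (h : IsKahler Ω Θ g) :
    IsSymplecticConnection Ω (leviCivita g) where
  smooth := isSmoothConnection_leviCivita g
  torsionFree := isTorsionFree_leviCivita g
  parallel X Y Z hX hY hZ x := by
    have hK := h.almostKahler
    have hΘ := hK.almostComplex.smooth
    have e : pair Ω Y Z = pair g.inner (act Θ Y) Z := funext fun y ↦ hK.fundamental _ _ _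
    have h1 := inner_leviCivita g (hX.mdiffAt x) ((hY.act hΘ).mdiffAt x) (hZ.mdiffAt x)
    have h2 := inner_leviCivita g (hX.mdiffAt x) (hY.mdiffAt x) ((hZ.act hΘ).mdiffAt x)
    have h3 := h.koszul_act_add_koszul_act hX hY hZ x
    rw [e, lieDeriv_inner_eq_leviCivita g (hX.mdiffAt x) ((hY.act hΘ).mdiffAt x) (hZ.mdiffAt x)]
    simp only [pair, along, hK.fundamental x (Y x)]
    rw [hK.omega_eq, act] at *
    linear_combination h1 + h2 + h3 / 2

lemma IsKahler.isStatisticalAlmostKahler (h : IsKahler Ω Θ g) :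
    IsStatisticalAlmostKahler Ω Θ g :=
  ⟨h.almostKahler, (leviCivita g, leviCivita g),
    ⟨h.isSymplecticConnection_leviCivita, isDual_leviCivita g⟩,
    isDual_leviCivita g, isTorsionFree_leviCivita g, isTorsionFree_leviCivita g⟩

variable [T2Space M]

omit [CompleteSpace E] in
/-- The dual `∇*` of a symplectic connection is `-Θ ∇ Θ`. -/
lemma IsAlmostKahler.act_along_eq_along_act (h : IsAlmostKahler Ω Θ g) {D D' : LinearConnection I M}
    (hD : IsParallel D Ω) (hdual : IsDual g D D') {X Y : Field I M} (hX : IsSmoothField X)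
    (hY : IsSmoothField Y) (x : M) : Θ x (along D' X Y x) = along D X (act Θ Y) x := by
  have key : along D' X Y x = -Θ x (along D X (act Θ Y) x) := by
    refine g.eq_of_forall_inner fun u ↦ ?_
    obtain ⟨Z, hZ, rfl⟩ := exists_isSmoothField_eq x u
    have h1 := hdual.duality X Z Y hX hZ hY x
    have h2 := hD X Z (act Θ Y) hX hZ (hY.act h.almostComplex.smooth) x
    have e : pair Ω Z (act Θ Y) = pair g.inner Z Y := funext fun y ↦ (h.inner_eq_omega _ _).symm
    rw [e, h1] at h2
    simp only [pair, act, ← h.inner_eq_omega] at h2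
    rw [h.omega_eq] at h2
    rw [g.symm, map_neg, neg_apply, g.symm x (Θ x _)]
    linear_combination h2
  rw [key, map_neg, h.almostComplex.sq, neg_neg]

lemma IsAlmostKahler.isIntegrable_of_isDual (h : IsAlmostKahler Ω Θ g) {D D' : LinearConnection I M}
    (hD : IsParallel D Ω) (hdual : IsDual g D D') (hT : IsTorsionFree D) (hT' : IsTorsionFree D') :
    IsIntegrable Θ := by
  have hΘ := h.almostComplex.smooth
  have key {X Y : Field I M} (hX : IsSmoothField X) (hY : IsSmoothField Y) (x : M) :
      Θ x (VectorField.mlieBracket I X Y x) =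
        along D X (act Θ Y) x - along D Y (act Θ X) x := by
    rw [← (D'.torsion_eq_zero_iff.1 hT') (hX.mdiffAt x) (hY.mdiffAt x), map_sub]
    exact congr($(h.act_along_eq_along_act hD hdual hX hY x) -
      $(h.act_along_eq_along_act hD hdual hY hX x))
  intro X Y hX hY x
  have hX' := hX.act hΘ
  have hY' := hY.act hΘ
  have hact (Z : Field I M) : act Θ (act Θ Z) = -Z := funext fun y ↦ h.almostComplex.sq y _
  have hneg {Z : Field I M} (hZ : IsSmoothField Z) : D (-Z) x = -D Z x := by
    have := D.isCovariantDerivativeOnUniv.smul_const (-1 : ℝ) (hZ.mdiffAt x)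
    simpa using this
  rw [nijenhuis, key hX' hY, key hX hY', hact, hact,
    ← (D.torsion_eq_zero_iff.1 hT) (hX.mdiffAt x) (hY.mdiffAt x),
    ← (D.torsion_eq_zero_iff.1 hT) (hX'.mdiffAt x) (hY'.mdiffAt x)]
  simp only [along, hneg hX, hneg hY, neg_apply]
  abel

lemma IsStatisticalAlmostKahler.isKahler (h : IsStatisticalAlmostKahler Ω Θ g) :
    IsKahler Ω Θ g := by
  obtain ⟨hK, ⟨D, D'⟩, ⟨hD, hdual⟩, hs⟩ := h
  exact ⟨hK, hK.isIntegrable_of_isDual hD.parallel hdual hD.torsionFree hs.torsionFree_right⟩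

end Kahler

end AlmostKahlerGeometry

theorem mainTheorem6 {E : Type*} [NormedAddCommGroup E] [NormedSpace ℝ E]
    [FiniteDimensional ℝ E] [CompleteSpace E]
    {H : Type*} [TopologicalSpace H] {I : ModelWithCorners ℝ E H} [I.Boundaryless]
    {M : Type*} [TopologicalSpace M] [T2Space M] [ChartedSpace H M] [IsManifold I ∞ M]
    (Ω : AlmostKahlerGeometry.BilinField I M) (Θ : AlmostKahlerGeometry.EndField I M)
    (g : AlmostKahlerGeometry.Metric I M) (hM : AlmostKahlerGeometry.IsAlmostKahler Ω Θ g) :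
    (AlmostKahlerGeometry.IsKahler Ω Θ g ↔
      AlmostKahlerGeometry.IsStatisticalAlmostKahler Ω Θ g) ∧
    (∀ h : AlmostKahlerGeometry.Metric I M,
      AlmostKahlerGeometry.IsKahlerMetric Ω h ↔
        AlmostKahlerGeometry.IsHermitianMetric Ω h ∧
        ∃ D D' : AlmostKahlerGeometry.LinearConnection I M,
          AlmostKahlerGeometry.IsSymplecticConnection Ω D ∧
          AlmostKahlerGeometry.IsDual h D D' ∧
          AlmostKahlerGeometry.IsSymplecticConnection Ω D') := by
  refine ⟨⟨fun h ↦ h.isStatisticalAlmostKahler, fun h ↦ h.isKahler⟩, fun h ↦ ⟨?_, ?_⟩⟩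
  · rintro ⟨J, hJ⟩
    exact ⟨⟨J, hJ.almostKahler⟩, _, _, hJ.isSymplecticConnection_leviCivita,
      AlmostKahlerGeometry.isDual_leviCivita h, hJ.isSymplecticConnection_leviCivita⟩
  · rintro ⟨⟨J, hJ⟩, D, D', hD, hdual, hD'⟩
    exact ⟨J, hJ, hJ.isIntegrable_of_isDual hD.parallel hdual hD.torsionFree hD'.torsionFree⟩
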